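/- Let $|\psi\rangle\in\mathbb C^2\otimes\mathbb C^2\otimes\mathbb C^2$ be a unit vector (a pure three-qubit state of parties $A,B,C$), and let $\rho_{AB},\rho_{AC},\rho_{BC}$ be its two-qubit reduced states, i.e. the partial traces of $|\psi\rangle\langle\psi|$ over the remaining party. For a pair $P\in\{AB,AC,BC\}$ let $T_P=(t^P_{ij})_{i,j=1}^{3}$ with $t^P_{ij}=\operatorname{Tr}[\rho_P\,(\sigma_i\otimes\sigma_j)]$ be the correlation matrix ($\sigma_1,\sigma_2,\sigma_3$ being the Pauli matrices), and put $S_P=\operatorname{Tr}[T_P^{T}T_P]$. Let $\mathcal C_P=\max\{0,\lambda_1-\lambda_2-\lambda_3-\lambda_4\}$ be the (Wootters) concurrence of $\rho_P$, where $\lambda_1\ge\lambda_2\ge\lambda_3\ge\lambda_4$ are the square roots of the eigenvalues, with multiplicity, of $\rho_P\,(\sigma_2\otimes\sigma_2)\,\overline{\rho_P}\,(\sigma_2\otimes\sigma_2)$, the bar denoting entrywise complex conjugation in the computational basis. Then for all $P,Q\in\{AB,AC,BC\}$ $$S_P-S_Q=3\,(\mathcal C_P^2-\mathcal C_Q^2);$$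 in particular $S_{AB}-S_{AC}=3(\mathcal C_{AB}^2-\mathcal C_{AC}^2)$, and likewise under permutations of the parties. Hence the triples $(S_{AB},S_{AC},S_{BC})$, $(\mathcal C_{AB},\mathcal C_{AC},\mathcal C_{BC})$ and $(\mathcal C_{AB}^2,\mathcal C_{AC}^2,\mathcal C_{BC}^2)$ are ordered in the same way: for all $P,Q$, $S_P>S_Q$ iff $\mathcal C_P>\mathcal C_Q$ iff $\mathcal C_P^2>\mathcal C_Q^2$, and $S_P=S_Q$ iff $\mathcal C_P=\mathcal C_Q$ iff $\mathcal C_P^2=\mathcal C_Q^2$. In particular, for all $P,Q,R\in\{AB,AC,BC\}$, $S_P>S_Q>S_R$ if and only if $\mathcal C_P>\mathcal C_Q>\mathcal C_R$; for instance $S_{AB}>S_{AC}>S_{BC}$ if and only if $\mathcal C_{AB}>\mathcal C_{AC}>\mathcal C_{BC}$. -/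

import Mathlib

open scoped Kronecker

noncomputable section

namespace ThreeQubit

/-- The Pauli matrices `σ₁, σ₂, σ₃` (that is, `σ_x, σ_y, σ_z`), indexed by `Fin 3`. -/
def pauli : Fin 3 → Matrix (Fin 2) (Fin 2) ℂ :=
  ![!![0, 1; 1, 0], !![0, -Complex.I; Complex.I, 0], !![1, 0; 0, -1]]

/-- The three pairs of parties among Alice, Bob and Charlie. -/
inductive Pair
  | AB
  | AC
  | BC

/-- The density matrix `|ψ⟩⟨ψ|` of a three-qubit vector, whose coordinates in the computational
basis `|a b c⟩` are indexed by triples `(a, b, c)`. -/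
def density (ψ : EuclideanSpace ℂ (Fin 2 × Fin 2 × Fin 2)) :
    Matrix (Fin 2 × Fin 2 × Fin 2) (Fin 2 × Fin 2 × Fin 2) ℂ :=
  Matrix.of fun x y => ψ x * star (ψ y)

/-- The reduced state of a pair of parties: the partial trace over the remaining party. -/
def reduced (ρ : Matrix (Fin 2 × Fin 2 × Fin 2) (Fin 2 × Fin 2 × Fin 2) ℂ) :
    Pair → Matrix (Fin 2 × Fin 2) (Fin 2 × Fin 2) ℂ
  | Pair.AB => Matrix.of fun x y => ∑ c, ρ (x.1, x.2, c) (y.1, y.2, c)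
  | Pair.AC => Matrix.of fun x y => ∑ b, ρ (x.1, b, x.2) (y.1, b, y.2)
  | Pair.BC => Matrix.of fun x y => ∑ a, ρ (a, x.1, x.2) (a, y.1, y.2)

/-- The correlation matrix `t_{ij} = Tr[ρ (σ_i ⊗ σ_j)]` of a two-qubit state. The trace is real
because `ρ` is Hermitian. -/
def correlation (ρ : Matrix (Fin 2 × Fin 2) (Fin 2 × Fin 2) ℂ) : Matrix (Fin 3) (Fin 3) ℝ :=
  Matrix.of fun i j => ((ρ * (pauli i ⊗ₖ pauli j)).trace).re

/-- The steering quantity `S = Tr[Tᵀ T]` of a two-qubit state, with `T` its correlation matrix. -/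
def steering (ρ : Matrix (Fin 2 × Fin 2) (Fin 2 × Fin 2) ℂ) : ℝ :=
  ((correlation ρ).transpose * correlation ρ).trace

/-- The spin-flipped state `(σ_y ⊗ σ_y) ρ* (σ_y ⊗ σ_y)`, where `ρ*` is the entrywise complex
conjugate of `ρ` in the computational basis. -/
def spinFlip (ρ : Matrix (Fin 2 × Fin 2) (Fin 2 × Fin 2) ℂ) :
    Matrix (Fin 2 × Fin 2) (Fin 2 × Fin 2) ℂ :=
  (pauli 1 ⊗ₖ pauli 1) * ρ.map star * (pauli 1 ⊗ₖ pauli 1)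

/-- The square roots of the eigenvalues of `ρ · spinFlip ρ`, with algebraic multiplicity, in
decreasing order. For a state `ρ` these eigenvalues are real and nonnegative. -/
def wootters (ρ : Matrix (Fin 2 × Fin 2) (Fin 2 × Fin 2) ℂ) : List ℝ :=
  ((ρ * spinFlip ρ).charpoly.roots.map fun z => √z.re).sort (· ≥ ·)

/-- The concurrence `max {0, λ₁ - λ₂ - λ₃ - λ₄}` of a two-qubit state, where
`λ₁ ≥ λ₂ ≥ λ₃ ≥ λ₄` are the square roots of the eigenvalues of `ρ · spinFlip ρ`. -/
def concurrence (ρ : Matrix (Fin 2 × Fin 2) (Fin 2 × Fin 2) ℂ) : ℝ :=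
  max 0 ((wootters ρ).getD 0 0 - (wootters ρ).getD 1 0 - (wootters ρ).getD 2 0
    - (wootters ρ).getD 3 0)

/-- `S` of the reduced state of the pair `P` of the pure three-qubit state `ψ`. -/
def S (ψ : EuclideanSpace ℂ (Fin 2 × Fin 2 × Fin 2)) (P : Pair) : ℝ :=
  steering (reduced (density ψ) P)

/-- The concurrence of the reduced state of the pair `P` of the pure three-qubit state `ψ`. -/
def C (ψ : EuclideanSpace ℂ (Fin 2 × Fin 2 × Fin 2)) (P : Pair) : ℝ :=
  concurrence (reduced (density ψ) P)

end ThreeQubit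

end

noncomputable section

namespace ThreeQubit

open Matrix

/-! Write `ρ_P = V Vᴴ` with `V` of size 4 × 2, and let `G = Vᵀ (σ_y ⊗ σ_y) V`. The nonzero Wootters
numbers are singular values of the 2 × 2 matrix `G`, so the concurrence is their difference and `C²
= ‖G‖_F² - 2 |det G|` (`concurrence_sq`). Two quantities do not depend on the pair: `det G`
(`det_spinGram_amplitudes`) and `S - 3 ‖G‖_F²` (`steering_sub_frobSq`). Subtracting gives the
identity; the orderings follow since `C ≥ 0`. -/

/-- A three-qubit tensor as a matrix from the third qubit to the first two. -/
def flatten (t : Fin 2 → Fin 2 → Fin 2 → ℂ) : Matrix (Fin 2 × Fin 2) (Fin 2) ℂ :=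
  Matrix.of fun x c => t x.1 x.2 c

/-- The Gram matrix of the columns of `V` for the bilinear form `σ_y ⊗ σ_y`. -/
def spinGram (V : Matrix (Fin 2 × Fin 2) (Fin 2) ℂ) : Matrix (Fin 2) (Fin 2) ℂ :=
  Vᵀ * (pauli 1 ⊗ₖ pauli 1) * V

/-- The squared Frobenius norm of a `2 × 2` matrix. -/
def frobSq (A : Matrix (Fin 2) (Fin 2) ℂ) : ℝ :=
  ∑ i, ∑ j, Complex.normSq (A i j)

/-- The amplitudes of `ψ`, with the pair `P` of parties first and the remaining party last. -/
def amplitudes (ψ : EuclideanSpace ℂ (Fin 2 × Fin 2 × Fin 2)) :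
    Pair → Fin 2 → Fin 2 → Fin 2 → ℂ
  | Pair.AB => fun a b c => ψ (a, b, c)
  | Pair.AC => fun a c b => ψ (a, b, c)
  | Pair.BC => fun b c a => ψ (a, b, c)

theorem reduced_density (ψ : EuclideanSpace ℂ (Fin 2 × Fin 2 × Fin 2)) (P : Pair) :
    reduced (density ψ) P = flatten (amplitudes ψ P) * (flatten (amplitudes ψ P))ᴴ := by
  ext x y
  cases P <;> simp [reduced, density, flatten, amplitudes, Matrix.mul_apply]

theorem kronecker_pauli_conjTranspose :
    (pauli 1 ⊗ₖ pauli 1)ᴴ = pauli 1 ⊗ₖ pauli 1 := by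
  ext ⟨a, b⟩ ⟨c, d⟩
  fin_cases a <;> fin_cases b <;> fin_cases c <;> fin_cases d <;> simp [pauli]

theorem spinGram_flatten (t : Fin 2 → Fin 2 → Fin 2 → ℂ) (i j : Fin 2) :
    spinGram (flatten t) i j =
      t 0 1 i * t 1 0 j + t 1 0 i * t 0 1 j - t 0 0 i * t 1 1 j - t 1 1 i * t 0 0 j := by
  simp [spinGram, flatten, Matrix.mul_apply, Fintype.sum_prod_type, pauli]
  ring

/-- `M N` and `N M` have the same characteristic polynomial up to a power of `X`; moving `V`
cyclically to the end turns the product into `Gᴴ G`. -/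
theorem charpoly_mul_spinFlip (V : Matrix (Fin 2 × Fin 2) (Fin 2) ℂ) :
    (V * Vᴴ * spinFlip (V * Vᴴ)).charpoly =
      Polynomial.X ^ 2 * ((spinGram V)ᴴ * spinGram V).charpoly := by
  have hconj : (V * Vᴴ).map star = Vᴴᵀ * Vᵀ := by
    ext x y
    simp [Matrix.mul_apply]
  have hgram : (spinGram V)ᴴ = Vᴴ * (pauli 1 ⊗ₖ pauli 1) * Vᴴᵀ := by
    simp only [spinGram, Matrix.conjTranspose_mul, kronecker_pauli_conjTranspose,
      Matrix.mul_assoc]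
    rfl
  have h := Matrix.charpoly_mul_comm' V
    (Vᴴ * (pauli 1 ⊗ₖ pauli 1) * Vᴴᵀ * (Vᵀ * (pauli 1 ⊗ₖ pauli 1)))
  have e1 : V * Vᴴ * spinFlip (V * Vᴴ) =
      V * (Vᴴ * (pauli 1 ⊗ₖ pauli 1) * Vᴴᵀ * (Vᵀ * (pauli 1 ⊗ₖ pauli 1))) := by
    simp only [spinFlip, hconj, Matrix.mul_assoc]
  have e2 : (spinGram V)ᴴ * spinGram V =
      Vᴴ * (pauli 1 ⊗ₖ pauli 1) * Vᴴᵀ * (Vᵀ * (pauli 1 ⊗ₖ pauli 1)) * V := by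
    rw [hgram]
    simp only [spinGram, Matrix.mul_assoc]
  rw [← e1, ← e2] at h
  simp only [Fintype.card_prod, Fintype.card_fin] at h
  -- The swap yields `X²` on the 4 × 4 side and `X⁴` on the 2 × 2 side.
  apply mul_left_cancel₀ (pow_ne_zero 2 (Polynomial.X_ne_zero (R := ℂ)))
  rw [h, ← mul_assoc, ← pow_add]

theorem charpoly_conjTranspose_mul_self (A : Matrix (Fin 2) (Fin 2) ℂ) :
    (Aᴴ * A).charpoly = Polynomial.X ^ 2 - Polynomial.C (frobSq A : ℂ) * Polynomial.X
      + Polynomial.C ((‖A.det‖ ^ 2 : ℝ) : ℂ) := by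
  have ht : (Aᴴ * A).trace = (frobSq A : ℂ) := by
    simp [Matrix.trace, Matrix.mul_apply, frobSq, Complex.normSq_eq_conj_mul_self]
    ring
  have hd : (Aᴴ * A).det = ((‖A.det‖ ^ 2 : ℝ) : ℂ) := by
    rw [Matrix.det_mul, Matrix.det_conjTranspose, ← Complex.normSq_eq_norm_sq,
      Complex.normSq_eq_conj_mul_self]
    rfl
  rw [Matrix.charpoly_fin_two, ht, hd]

theorem two_mul_norm_det_le_frobSq (A : Matrix (Fin 2) (Fin 2) ℂ) :
    2 * ‖A.det‖ ≤ frobSq A := by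
  have h : ‖A.det‖ ≤ ‖A 0 0‖ * ‖A 1 1‖ + ‖A 0 1‖ * ‖A 1 0‖ := by
    rw [Matrix.det_fin_two, ← norm_mul, ← norm_mul]
    exact norm_sub_le _ _
  simp only [frobSq, Fin.sum_univ_two, Complex.normSq_eq_norm_sq]
  nlinarith [sq_nonneg (‖A 0 0‖ - ‖A 1 1‖), sq_nonneg (‖A 0 1‖ - ‖A 1 0‖)]

theorem concurrence_sq (V : Matrix (Fin 2 × Fin 2) (Fin 2) ℂ) :
    concurrence (V * Vᴴ) ^ 2 = frobSq (spinGram V) - 2 * ‖(spinGram V).det‖ := by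
  set s := frobSq (spinGram V) with hs
  set d := ‖(spinGram V).det‖ with hd
  have hd0 : 0 ≤ d := norm_nonneg _
  have hsd : 2 * d ≤ s := two_mul_norm_det_le_frobSq _
  -- Root of the discriminant of `X² - s X + d²`, real by `hsd`; `e₁` and `e₂` are the squared
  -- singular values of `G`.
  set r := √(s ^ 2 - 4 * d ^ 2) with hr
  have hr0 : 0 ≤ r := Real.sqrt_nonneg _
  have hr2 : r ^ 2 = s ^ 2 - 4 * d ^ 2 := Real.sq_sqrt (by nlinarith)
  have hrs : r ≤ s := by nlinarith
  set e₁ := (s + r) / 2 with he₁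
  set e₂ := (s - r) / 2 with he₂
  have h₁ : 0 ≤ e₁ := by linarith
  have h₂ : 0 ≤ e₂ := by linarith
  have hle : √e₂ ≤ √e₁ := Real.sqrt_le_sqrt (by linarith)
  have hsum : e₁ + e₂ = s := by ring
  have hprod : e₁ * e₂ = d ^ 2 := by nlinarith
  have hchar : (V * Vᴴ * spinFlip (V * Vᴴ)).charpoly =
      (({(e₁ : ℂ), (e₂ : ℂ), 0, 0} : Multiset ℂ).map
        fun a => Polynomial.X - Polynomial.C a).prod := by
    rw [charpoly_mul_spinFlip, charpoly_conjTranspose_mul_self, ← hs, ← hd, ← hsum, ← hprod]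
    simp
    ring
  have hw : wootters (V * Vᴴ) = [√e₁, √e₂, 0, 0] := by
    rw [wootters, hchar, Polynomial.roots_multiset_prod_X_sub_C]
    have : (({(e₁ : ℂ), (e₂ : ℂ), 0, 0} : Multiset ℂ).map fun z => √z.re) =
        (([√e₁, √e₂, 0, 0] : List ℝ) : Multiset ℝ) := by
      simp
      rfl
    rw [this, Multiset.coe_sort]
    apply List.mergeSort_of_pairwise
    simp [hle]
  have hc : concurrence (V * Vᴴ) = √e₁ - √e₂ := by
    rw [concurrence, hw]
    simp [hle]
  have hsq : √e₁ * √e₂ = d := by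
    rw [← Real.sqrt_mul h₁, hprod, Real.sqrt_sq hd0]
  rw [hc]
  nlinarith [Real.sq_sqrt h₁, Real.sq_sqrt h₂]

theorem concurrence_nonneg (ρ : Matrix (Fin 2 × Fin 2) (Fin 2 × Fin 2) ℂ) :
    0 ≤ concurrence ρ := le_max_left _ _

/-- Up to sign this determinant is Cayley's hyperdeterminant of the 2 × 2 × 2 tensor, which is
invariant under permuting the parties. -/
theorem det_spinGram_amplitudes (ψ : EuclideanSpace ℂ (Fin 2 × Fin 2 × Fin 2)) (P : Pair) :
    (spinGram (flatten (amplitudes ψ P))).det =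
      (spinGram (flatten (amplitudes ψ Pair.AB))).det := by
  cases P <;> simp only [Matrix.det_fin_two, spinGram_flatten, amplitudes] <;> ring

theorem steering_mul_conjTranspose (V : Matrix (Fin 2 × Fin 2) (Fin 2) ℂ) :
    steering (V * Vᴴ) =
      ∑ i, ∑ j, ((V * Vᴴ * (pauli i ⊗ₖ pauli j)).trace).re ^ 2 := by
  simp only [steering, correlation, Matrix.trace, Matrix.diag_apply, Matrix.mul_apply,
    Matrix.transpose_apply, Matrix.of_apply]
  rw [Finset.sum_comm]
  simp only [← sq]
theorem trace_flatten_mul_kronecker (t : Fin 2 → Fin 2 → Fin 2 → ℂ)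
    (A B : Matrix (Fin 2) (Fin 2) ℂ) :
    (flatten t * (flatten t)ᴴ * (A ⊗ₖ B)).trace =
      ∑ a, ∑ b, ∑ a', ∑ b', (∑ c, t a b c * star (t a' b' c)) * (A a' a * B b' b) := by
  simp only [Matrix.trace, Matrix.diag_apply, Matrix.mul_apply, Fintype.sum_prod_type, flatten,
    Matrix.of_apply, Matrix.conjTranspose_apply, Matrix.kroneckerMap_apply]

-- Conceptually, let `a, b, c` be the Bloch vectors of the three parties and `n = ‖ψ‖`. Equal purity
-- of complementary reductions gives `S_AB = n⁴ + 2|c|² - |a|² - |b|²`, and `‖G‖_F² = Tr(ρ ρ̃) = (n⁴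
-- + |c|² - |a|² - |b|²)/2`, with `ρ̃` the spin flip. The difference is `(|a|² + |b|² + |c|² -
-- n⁴)/2`, symmetric in the parties. The proof checks the invariance by expansion in real and
-- imaginary parts.
set_option maxHeartbeats 2000000 in
theorem steering_sub_frobSq (ψ : EuclideanSpace ℂ (Fin 2 × Fin 2 × Fin 2)) (P : Pair) :
    steering (flatten (amplitudes ψ P) * (flatten (amplitudes ψ P))ᴴ)
        - 3 * frobSq (spinGram (flatten (amplitudes ψ P))) =
      steering (flatten (amplitudes ψ Pair.AB) * (flatten (amplitudes ψ Pair.AB))ᴴ)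
        - 3 * frobSq (spinGram (flatten (amplitudes ψ Pair.AB))) := by
  cases P
  · rfl
  all_goals
    simp only [steering_mul_conjTranspose, trace_flatten_mul_kronecker, frobSq,
      spinGram_flatten, Fin.sum_univ_three, Fin.sum_univ_two, amplitudes]
    simp [pauli, Complex.normSq_apply, -mul_eq_mul_left_iff]
    ring

end ThreeQubit

end

theorem theorem2 (ψ : EuclideanSpace ℂ (Fin 2 × Fin 2 × Fin 2)) (hψ : ‖ψ‖ = 1) :
    (∀ P Q : ThreeQubit.Pair,
      ThreeQubit.S ψ P - ThreeQubit.S ψ Q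
        = 3 * (ThreeQubit.C ψ P ^ 2 - ThreeQubit.C ψ Q ^ 2)) ∧
    (∀ P Q : ThreeQubit.Pair,
      (ThreeQubit.S ψ P > ThreeQubit.S ψ Q ↔ ThreeQubit.C ψ P ^ 2 > ThreeQubit.C ψ Q ^ 2) ∧
      (ThreeQubit.S ψ P = ThreeQubit.S ψ Q ↔ ThreeQubit.C ψ P ^ 2 = ThreeQubit.C ψ Q ^ 2) ∧
      (ThreeQubit.S ψ P > ThreeQubit.S ψ Q ↔ ThreeQubit.C ψ P > ThreeQubit.C ψ Q) ∧
      (ThreeQubit.S ψ P = ThreeQubit.S ψ Q ↔ ThreeQubit.C ψ P = ThreeQubit.C ψ Q)) ∧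
    (∀ P Q R : ThreeQubit.Pair,
      (ThreeQubit.S ψ P > ThreeQubit.S ψ Q ∧ ThreeQubit.S ψ Q > ThreeQubit.S ψ R) ↔
      (ThreeQubit.C ψ P > ThreeQubit.C ψ Q ∧ ThreeQubit.C ψ Q > ThreeQubit.C ψ R)) := by
  have hC0 : ∀ P, 0 ≤ ThreeQubit.C ψ P := fun P => ThreeQubit.concurrence_nonneg _
  have hmain : ∀ P Q : ThreeQubit.Pair, ThreeQubit.S ψ P - ThreeQubit.S ψ Q
      = 3 * (ThreeQubit.C ψ P ^ 2 - ThreeQubit.C ψ Q ^ 2) := by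
    intro P Q
    simp only [ThreeQubit.S, ThreeQubit.C, ThreeQubit.reduced_density,
      ThreeQubit.concurrence_sq, ThreeQubit.det_spinGram_amplitudes ψ P,
      ThreeQubit.det_spinGram_amplitudes ψ Q]
    linarith [ThreeQubit.steering_sub_frobSq ψ P, ThreeQubit.steering_sub_frobSq ψ Q]
  have hgt : ∀ P Q : ThreeQubit.Pair,
      ThreeQubit.S ψ P > ThreeQubit.S ψ Q ↔ ThreeQubit.C ψ P ^ 2 > ThreeQubit.C ψ Q ^ 2 :=
    fun P Q => ⟨fun h => by linarith [hmain P Q], fun h => by linarith [hmain P Q]⟩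
  have heq : ∀ P Q : ThreeQubit.Pair,
      ThreeQubit.S ψ P = ThreeQubit.S ψ Q ↔ ThreeQubit.C ψ P ^ 2 = ThreeQubit.C ψ Q ^ 2 :=
    fun P Q => ⟨fun h => by linarith [hmain P Q], fun h => by linarith [hmain P Q]⟩
  have hgt' : ∀ P Q : ThreeQubit.Pair,
      ThreeQubit.S ψ P > ThreeQubit.S ψ Q ↔ ThreeQubit.C ψ P > ThreeQubit.C ψ Q :=
    fun P Q => (hgt P Q).trans (sq_lt_sq₀ (hC0 Q) (hC0 P))
  exact ⟨hmain, fun P Q => ⟨hgt P Q, heq P Q, hgt' P Q,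
    (heq P Q).trans (sq_eq_sq₀ (hC0 P) (hC0 Q))⟩,
    fun P Q R => and_congr (hgt' P Q) (hgt' Q R)⟩
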